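/- \textbf{Proposition (KKT/envelope sensitivity of the robust value function).} Let $X\subseteq\mathbb{R}^{n}$ be closed and convex, let $f:\mathbb{R}^{n}\to\mathbb{R}\cup\{+\infty\}$ and $a_1,\dots,a_m:\mathbb{R}^{n}\to\mathbb{R}$ be convex, let $w_1,\dots,w_m\in\mathbb{R}^d$ ($d\ge1$), $b_1,\dots,b_m\in\mathbb{R}$, and let $\Theta\subseteq\mathbb{R}^p$. For $\theta\in\Theta$ and $\rho>0$ put $U_{\theta,\rho}=\{u\in\mathbb{R}^d: s_\theta(u)\le\rho\}$, where $s_\theta:\mathbb{R}^d\to[0,\infty)$ is the gauge of $U_{\theta,1}$. For $C\subseteq\mathbb{R}^d$ let $\sigma_C(w)=\sup_{u\in C}\langle w,u\rangle$. Define $$V(\theta,\rho)=\inf\{f(x): x\in X,\ a_j(x)+\sigma_{U_{\theta,\rho}}(w_j)\le b_j\ (1\le j\le m)\}$$ (with $\inf\emptyset=+\infty$), and for $\mu\in\mathbb{R}^m_{\ge0}$ $$q(\mu;\theta,\rho)=\inf_{x\in X}\Big\{f(x)+\sum_{j=1}^m\mu_j\big(a_j(x)+\sigma_{U_{\theta,\rho}}(w_j)-b_j\big)\Big\},\qquad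 M^*(\theta,\rho)=\operatorname*{arg\,max}_{\mu\ge0}q(\mu;\theta,\rho).$$ For a function $h$ that is finite and Lipschitz near $x$, let $\partial^{\mathrm C}h(x)$ be the convex hull of all limits $\lim_k\nabla h(x_k)$ with $x_k\to x$ and $h$ differentiable at each $x_k$. Assume: \begin{itemize} \item for each $\theta\in\Theta$, $U_{\theta,1}$ is nonempty, convex and compact, with $0$ in its interior; \item for each $j$ and each $\rho>0$, the map $\theta\mapsto\sigma_{U_{\theta,\rho}}(w_j)$ is continuously differentiable with locally bounded gradient on the interior of $\Theta$. \end{itemize} Fix $\theta$ in the interior of $\Theta$ and $\rho>0$ with $V(\theta,\rho)<+\infty$, and assume that $\inf_{X}f>-\infty$ and that there is a point $\bar x$ in the relative interior of $X$ with $f(\bar x)<+\infty$ and $a_j(\bar x)+\sigma_{U_{\theta,\rho}}(w_j)<b_j$ for all $j$. Let $\mu^*\in M^*(\theta,\rho)$. Then: (a) $V(\cdot,\rho)$ is finite and Lipschitz near $\theta$, and $$\sum_{j=1}^m\mu_j^*\,\nabla_\theta\sigma_{U_{\theta,\rho}}(w_j)\in\partial^{\mathrm C}_\theta V(\theta,\rho).$$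 If moreover $M^*(\theta,\rho)=\{\mu^*\}$, then $V(\cdot,\rho)$ is differentiable at $\theta$, and its gradient there is this vector. (b) $V(\theta,\cdot)$ is finite and Lipschitz near $\rho$, and $$\sum_{j=1}^m\mu_j^*\,\sigma_{U_{\theta,1}}(w_j)\in\partial^{\mathrm C}_\rho V(\theta,\rho).$$ -/

import Mathlib

open Set Filter Topology
open scoped Pointwise

noncomputable section

namespace RobustDispatch

/-- The Euclidean space `ℝⁿ`. -/
abbrev Vec (n : ℕ) : Type := EuclideanSpace ℝ (Fin n)

/-- The uncertainty set `U_{θ,ρ} = {u : s_θ(u) ≤ ρ}` of a shape-dependent score `s`. -/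
def uncertaintySet {p d : ℕ} (s : Vec p → Vec d → ℝ) (θ : Vec p) (ρ : ℝ) : Set (Vec d) :=
  {u | s θ u ≤ ρ}

/-- The support function `σ_C(w) = sup_{u ∈ C} ⟨w, u⟩`
(a genuine supremum whenever `C` is nonempty and bounded). -/
def supportFunction {d : ℕ} (C : Set (Vec d)) (w : Vec d) : ℝ :=
  sSup ((fun u => inner ℝ w u) '' C)

/-- For every shape in `Θ`, the score is the gauge (Minkowski functional) of its unit set, and the
unit set is nonempty, convex, compact, with the origin in its interior. -/
structure GaugeRegular {p d : ℕ} (Θ : Set (Vec p)) (s : Vec p → Vec d → ℝ) : Prop where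
  eq_gauge : ∀ θ ∈ Θ, s θ = gauge (uncertaintySet s θ 1)
  nonempty : ∀ θ ∈ Θ, (uncertaintySet s θ 1).Nonempty
  convex : ∀ θ ∈ Θ, Convex ℝ (uncertaintySet s θ 1)
  isCompact : ∀ θ ∈ Θ, IsCompact (uncertaintySet s θ 1)
  zero_mem_interior : ∀ θ ∈ Θ, (0 : Vec d) ∈ interior (uncertaintySet s θ 1)

/-- The data of the convex dispatch problem: a closed convex decision set `X`, a convex objective
`f` with values in `ℝ ∪ {+∞}`, convex constraint functions `a j`, exposure vectors `w j` and
scalars `b j`. Convexity of the extended-valued `f` is convexity of its epigraph. -/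
structure DispatchProblem (n d m : ℕ) where
  X : Set (Vec n)
  f : Vec n → EReal
  a : Fin m → Vec n → ℝ
  w : Fin m → Vec d
  b : Fin m → ℝ
  X_closed : IsClosed X
  X_convex : Convex ℝ X
  f_ne_bot : ∀ x, f x ≠ ⊥
  f_convex : Convex ℝ {z : Vec n × ℝ | f z.1 ≤ (z.2 : EReal)}
  a_convex : ∀ j, ConvexOn ℝ univ (a j)

namespace DispatchProblem

variable {n d m p : ℕ}

/-- The map `(θ, ρ) ↦ σ_{U_{θ,ρ}}(w_j)`. -/
def exposure (P : DispatchProblem n d m) (s : Vec p → Vec d → ℝ) (j : Fin m)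
    (θ : Vec p) (ρ : ℝ) : ℝ :=
  supportFunction (uncertaintySet s θ ρ) (P.w j)

/-- The feasible set of the robust problem. -/
def feasibleSet (P : DispatchProblem n d m) (s : Vec p → Vec d → ℝ)
    (θ : Vec p) (ρ : ℝ) : Set (Vec n) :=
  {x | x ∈ P.X ∧ ∀ j, P.a j x + P.exposure s j θ ρ ≤ P.b j}

/-- The robust value function `V(θ, ρ)`, equal to `+∞` if the feasible set is empty. -/
def value (P : DispatchProblem n d m) (s : Vec p → Vec d → ℝ) (θ : Vec p) (ρ : ℝ) : EReal :=
  ⨅ x ∈ P.feasibleSet s θ ρ, P.f x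

/-- The Lagrange dual function
`q(μ; θ, ρ) = inf_{x ∈ X} f(x) + ∑ j, μ j * (a_j(x) + σ_{U_{θ,ρ}}(w_j) - b_j)`. -/
def dual (P : DispatchProblem n d m) (s : Vec p → Vec d → ℝ) (θ : Vec p) (ρ : ℝ)
    (μ : Fin m → ℝ) : EReal :=
  ⨅ x ∈ P.X, P.f x + ((∑ j, μ j * (P.a j x + P.exposure s j θ ρ - P.b j) : ℝ) : EReal)

/-- The set `M*(θ, ρ) = argmax_{μ ≥ 0} q(μ; θ, ρ)` of optimal dual multipliers. -/
def optimalDuals (P : DispatchProblem n d m) (s : Vec p → Vec d → ℝ) (θ : Vec p) (ρ : ℝ) :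
    Set (Fin m → ℝ) :=
  {μ | 0 ≤ μ ∧ ∀ ν : Fin m → ℝ, 0 ≤ ν → P.dual s θ ρ ν ≤ P.dual s θ ρ μ}

/-- The objective is bounded below on `X`, and some point of the relative interior of `X` with
finite objective satisfies all constraints strictly. -/
structure LocalSlater (P : DispatchProblem n d m) (s : Vec p → Vec d → ℝ)
    (θ : Vec p) (ρ : ℝ) : Prop where
  bddBelow : ∃ c : ℝ, ∀ x ∈ P.X, (c : EReal) ≤ P.f x
  strictlyFeasible : ∃ x ∈ intrinsicInterior ℝ P.X,
    P.f x < ⊤ ∧ ∀ j, P.a j x + P.exposure s j θ ρ < P.b j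

/-- For each `j` and each radius `ρ > 0`, the map `θ ↦ σ_{U_{θ,ρ}}(w_j)` is continuously
differentiable with locally bounded gradient in the interior of `Θ`. -/
structure SupportSmooth (P : DispatchProblem n d m) (Θ : Set (Vec p))
    (s : Vec p → Vec d → ℝ) : Prop where
  contDiffOn : ∀ j, ∀ ρ : ℝ, 0 < ρ →
    ContDiffOn ℝ 1 (fun θ => P.exposure s j θ ρ) (interior Θ)
  gradient_locallyBounded : ∀ j, ∀ ρ : ℝ, 0 < ρ → ∀ θ ∈ interior Θ,
    ∃ C : ℝ, ∀ᶠ θ' in 𝓝 θ, ‖gradient (fun θ'' => P.exposure s j θ'' ρ) θ'‖ ≤ C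

end DispatchProblem

/-- The Clarke subdifferential of a function that is Lipschitz near `x`: the convex hull of all
limits of gradients along sequences of differentiability points converging to `x`. -/
def clarkeSubdifferential {E : Type*} [NormedAddCommGroup E] [InnerProductSpace ℝ E]
    [CompleteSpace E] (h : E → ℝ) (x : E) : Set E :=
  convexHull ℝ {g | ∃ y : ℕ → E, Tendsto y atTop (𝓝 x) ∧ (∀ k, DifferentiableAt ℝ h (y k)) ∧
    Tendsto (fun k => gradient h (y k)) atTop (𝓝 g)}

/-- `g` is a Clarke subgradient at `x` of the extended-valued function `F`: near `x`, `F` is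
finite and Lipschitz, so that its Clarke subdifferential at `x` makes sense, and `g` lies in it. -/
structure IsClarkeSubgradientAt {E : Type*} [NormedAddCommGroup E] [InnerProductSpace ℝ E]
    [CompleteSpace E] (F : E → EReal) (g x : E) : Prop where
  finite_near : ∀ᶠ y in 𝓝 x, F y ≠ ⊥ ∧ F y ≠ ⊤
  lipschitz_near : ∃ K : NNReal, ∃ t ∈ 𝓝 x, LipschitzOnWith K (fun y => (F y).toReal) t
  mem : g ∈ clarkeSubdifferential (fun y => (F y).toReal) x

end RobustDispatch

end

/-! ### Carathéodory: convex hulls of compact sets are compact. -/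

section ConvexHull

/-! The robust value is `perturbedValue` composed with the vector of exposures. Under Slater's
condition strong duality holds, so optimal dual multipliers are exactly the Kuhn-Tucker vectors
(`SlaterData.mem_optimalDuals_iff`). Such a vector `μ` at `z` gives the global bound v(z') ≥ v(z) +
⟨μ, z' - z⟩. Composed with smooth exposures, this is a differentiable minorant touching the value
function at the base point, with gradient the claimed vector.

It remains to see that the gradient of a touching minorant of a locally Lipschitz function is a
Clarke subgradient (`mem_clarkeSubdifferential_of_minorant`). Otherwise a separating direction
bounds all nearby directional derivatives strictly below the minorant's slope, and integration along
lines contradicts the touching.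

Multipliers are uniformly bounded near `z`, which makes v Lipschitz. If the multiplier is unique,
nearby ones converge to it and v is differentiable. Part (b) is the same argument in the radius,
where the exposure is linear. -/

theorem IsCompact.convexHull_of_finiteDimensional {E : Type*} [NormedAddCommGroup E]
    [NormedSpace ℝ E] [FiniteDimensional ℝ E] {s : Set E} (hs : IsCompact s) :
    IsCompact (convexHull ℝ s) := by
  set N := Module.finrank ℝ E
  let F : (Fin (N + 1) → ℝ) × (Fin (N + 1) → E) → E := fun q => ∑ i, q.1 i • q.2 i
  have hF : Continuous F := by fun_prop
  have hK : IsCompact (stdSimplex ℝ (Fin (N + 1)) ×ˢ (Set.pi univ fun _ : Fin (N + 1) => s)) :=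
    (isCompact_stdSimplex ℝ _).prod (isCompact_univ_pi fun _ => hs)
  have heq : convexHull ℝ s =
      F '' (stdSimplex ℝ (Fin (N + 1)) ×ˢ (Set.pi univ fun _ : Fin (N + 1) => s)) := by
    apply Subset.antisymm
    · intro x hx
      rw [convexHull_eq_union] at hx
      simp only [mem_iUnion] at hx
      obtain ⟨t, hts, hind, hxt⟩ := hx
      have hcard : t.card ≤ N + 1 := by
        have := hind.card_le_finrank_succ
        rw [Fintype.card_coe] at this
        exact this.trans (Nat.succ_le_succ (Submodule.finrank_le _))
      have hne : t.Nonempty := by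
        by_contra h
        rw [Finset.not_nonempty_iff_eq_empty] at h
        simp [h] at hxt
      have : Nonempty t := hne.to_subtype
      obtain ⟨e⟩ : Nonempty (t ↪ Fin (N + 1)) :=
        Function.Embedding.nonempty_of_card_le (by simpa using hcard)
      rw [Finset.mem_convexHull'] at hxt
      obtain ⟨w, hw0, hw1, hwx⟩ := hxt
      let g : Fin (N + 1) → t := Function.invFun e
      have hg : ∀ y, g (e y) = y := Function.leftInverse_invFun e.injective
      classical
      let w' : Fin (N + 1) → ℝ := fun i => if i ∈ range e then w (g i) else 0
      -- Missing indices are padded with weight zero. Pairing each point with 1 lets one identity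
      -- carry both the barycentre and the total weight.
      have key : ∑ i, w' i • ((g i : E), (1 : ℝ)) = ∑ y ∈ t, w y • (y, (1 : ℝ)) := by
        rw [← Finset.sum_coe_sort t (fun y => w y • (y, (1 : ℝ)))]
        symm
        apply Finset.sum_of_injOn e e.injective.injOn
        · simp
        · intro i _ hi
          have : i ∉ range e := by simpa only [Finset.coe_univ, image_univ] using hi
          simp only [w', if_neg this, zero_smul]
        · intro y _
          simp [w', hg]
      refine ⟨(w', fun i => (g i : E)), ⟨⟨fun i => ?_, ?_⟩, fun i _ => hts (g i).2⟩, ?_⟩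
      · dsimp only [w']
        split_ifs
        · exact hw0 _ (g i).2
        · exact le_rfl
      · simpa [Prod.snd_sum, hw1] using congrArg Prod.snd key
      · simpa [Prod.fst_sum, hwx, F] using congrArg Prod.fst key
    · rintro _ ⟨⟨w, z⟩, ⟨hw, hz⟩, rfl⟩
      exact (convex_convexHull ℝ s).sum_mem (fun i _ => hw.1 i) hw.2
        fun i _ => subset_convexHull ℝ s (hz i (mem_univ i))
  rw [heq]
  exact hK.image hF

end ConvexHull

/-! ### Clarke subgradients of Lipschitz functions -/

section Clarke

open MeasureTheory

/-- The segment from `x` itself may consist of non-differentiability points. By Rademacher and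
Fubini, for almost every `y` the line through `y` along `h` is differentiable almost everywhere;
integrate there and let `y` tend to `x`. -/
theorem LipschitzWith.sub_le_of_fderiv_le {E : Type*} [NormedAddCommGroup E] [NormedSpace ℝ E]
    [FiniteDimensional ℝ E] {f : E → ℝ} {K : NNReal} (hf : LipschitzWith K f) {x h : E}
    {r u t : ℝ} (hu : ∀ y ∈ Metric.ball x r, DifferentiableAt ℝ f y → fderiv ℝ f y h ≤ u)
    (ht : 0 ≤ t) (htr : t * ‖h‖ < r) : f (x + t • h) - f x ≤ t * u := by
  borelize E
  let μ : Measure E := Measure.addHaar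
  have hD : MeasurableSet {y | DifferentiableAt ℝ f y} := measurableSet_of_differentiableAt ℝ f
  have h1 : ∀ s : ℝ, ∀ᵐ y ∂μ, DifferentiableAt ℝ f (y + s • h) := fun s =>
    (measurePreserving_add_right μ (s • h)).quasiMeasurePreserving.ae hf.ae_differentiableAt
  have h2 : ∀ᵐ y ∂μ, ∀ᵐ s : ℝ, DifferentiableAt ℝ f (y + s • h) := by
    rw [Measure.ae_ae_comm]
    · exact ae_of_all _ h1
    · exact (show Measurable fun q : E × ℝ => q.1 + q.2 • h by fun_prop) hD
  have hdense := Measure.dense_of_ae h2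
  have hclosed : IsClosed {y | f (y + t • h) - f y ≤ t * u} := by
    have := hf.continuous
    exact isClosed_le (by fun_prop) continuous_const
  -- The reduced radius keeps the whole segment from `y` inside the ball of radius `r`.
  have hx : x ∈ closure (Metric.ball x (r - t * ‖h‖) ∩
      {y | ∀ᵐ s : ℝ, DifferentiableAt ℝ f (y + s • h)}) :=
    hdense.open_subset_closure_inter Metric.isOpen_ball (Metric.mem_ball_self (by linarith))
  refine closure_minimal ?_ hclosed hx
  rintro y ⟨hy, hys⟩
  have hlip : LipschitzWith (K * ‖h‖₊) fun s : ℝ => f (y + s • h) := by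
    refine hf.comp (LipschitzWith.of_dist_le_mul fun a b => ?_)
    rw [dist_add_left, dist_eq_norm, ← sub_smul, norm_smul, mul_comm, dist_eq_norm]
    rfl
  have hac := hlip.lipschitzOnWith (s := uIcc 0 t) |>.absolutelyContinuousOnInterval
  have hint := hac.integral_deriv_eq_sub
  simp only [zero_smul, add_zero] at hint
  rw [mem_ofPred_eq, ← hint]
  have hle : ∫ s in (0 : ℝ)..t, deriv (fun s : ℝ => f (y + s • h)) s ≤ ∫ _ in (0 : ℝ)..t, u := by
    have hii : IntervalIntegrable (deriv fun s : ℝ => f (y + s • h)) volume 0 t :=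
      hac.intervalIntegrable_deriv
    apply intervalIntegral.integral_mono_ae_restrict ht hii intervalIntegrable_const
    filter_upwards [ae_restrict_of_ae hys, ae_restrict_mem measurableSet_Icc] with s hs hst
    have hline : HasDerivAt (fun s : ℝ => y + s • h) h s := by
      simpa using ((hasDerivAt_id s).smul_const h).const_add y
    have hd : HasDerivAt (fun s : ℝ => f (y + s • h)) (fderiv ℝ f (y + s • h) h) s :=
      hs.hasFDerivAt.comp_hasDerivAt s hline
    rw [hd.deriv]
    refine hu _ ?_ hs
    rw [Metric.mem_ball, dist_eq_norm] at hy ⊢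
    have hsh : ‖s • h‖ ≤ t * ‖h‖ := by
      rw [norm_smul, Real.norm_of_nonneg hst.1]
      exact mul_le_mul_of_nonneg_right hst.2 (norm_nonneg _)
    calc ‖y + s • h - x‖ = ‖(y - x) + s • h‖ := by congr 1; abel
      _ ≤ ‖y - x‖ + ‖s • h‖ := norm_add_le _ _
      _ < r := by linarith
  simpa using hle

namespace RobustDispatch

variable {E : Type*} [NormedAddCommGroup E] [InnerProductSpace ℝ E]

theorem clarkeSubdifferential_congr [CompleteSpace E] {f g : E → ℝ} {x : E}
    (hfg : f =ᶠ[𝓝 x] g) : clarkeSubdifferential f x ⊆ clarkeSubdifferential g x := by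
  refine convexHull_mono ?_
  rintro v ⟨y, hy, hd, hv⟩
  obtain ⟨N, hN⟩ := eventually_atTop.1 (hy.eventually hfg.eventually_nhds)
  have hev : ∀ k, f =ᶠ[𝓝 (y (k + N))] g := fun k => hN (k + N) (Nat.le_add_left _ _)
  refine ⟨fun k => y (k + N), (tendsto_add_atTop_iff_nat N).2 hy, fun k => ?_, ?_⟩
  · exact (hev k).differentiableAt_iff.1 (hd _)
  · refine ((tendsto_add_atTop_iff_nat N).2 hv).congr fun k => ?_
    exact (hev k).gradient_eq

variable [FiniteDimensional ℝ E]

/-- The limiting gradients are the slice at `x` of the closure of the graph of the gradient, and all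
gradients have norm at most `K`. -/
theorem isCompact_clarkeSubdifferential_of_lipschitzWith {f : E → ℝ} {K : NNReal}
    (hf : LipschitzWith K f) (x : E) :
    IsCompact {g | ∃ y : ℕ → E, Tendsto y atTop (𝓝 x) ∧ (∀ k, DifferentiableAt ℝ f (y k)) ∧
      Tendsto (fun k => gradient f (y k)) atTop (𝓝 g)} := by
  set G : Set (E × E) := {q | DifferentiableAt ℝ f q.1 ∧ q.2 = gradient f q.1}
  have heq : {g | ∃ y : ℕ → E, Tendsto y atTop (𝓝 x) ∧ (∀ k, DifferentiableAt ℝ f (y k)) ∧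
      Tendsto (fun k => gradient f (y k)) atTop (𝓝 g)} = (fun g => (x, g)) ⁻¹' closure G := by
    ext g
    simp only [mem_preimage, mem_closure_iff_seq_limit, mem_ofPred_eq]
    constructor
    · rintro ⟨y, hy, hd, hg⟩
      exact ⟨fun k => (y k, gradient f (y k)), fun k => ⟨hd k, rfl⟩, hy.prodMk_nhds hg⟩
    · rintro ⟨q, hq, hlim⟩
      rw [nhds_prod_eq] at hlim
      exact ⟨fun k => (q k).1, hlim.fst, fun k => (hq k).1,
        hlim.snd.congr fun k => (hq k).2⟩
  rw [heq]
  have hclosed : IsClosed ((fun g : E => (x, g)) ⁻¹' closure G) :=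
    isClosed_closure.preimage (by fun_prop)
  refine (isCompact_closedBall (0 : E) K).of_isClosed_subset hclosed fun g hg => ?_
  have hG : closure G ⊆ {q | ‖q.2‖ ≤ K} := by
    refine closure_minimal ?_ (isClosed_le (by fun_prop) continuous_const)
    rintro ⟨y, v⟩ ⟨-, hv : v = gradient f y⟩
    subst hv
    simpa [gradient] using norm_fderiv_le_of_lipschitz ℝ hf
  simpa using hG hg

/-- A Fréchet subgradient of a locally Lipschitz function, here given as the gradient of a function
that touches `f` from below at `x`, is a Clarke subgradient. -/
theorem mem_clarkeSubdifferential_of_minorant {f φ : E → ℝ} {K : NNReal} {t : Set E} {x g : E}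
    (ht : t ∈ 𝓝 x) (hf : LipschitzOnWith K f t) (hφ : HasGradientAt φ g x)
    (hle : ∀ᶠ y in 𝓝 x, φ y ≤ f y) (hx : φ x = f x) : g ∈ clarkeSubdifferential f x := by
  obtain ⟨F, hF, hFf⟩ := hf.extend_real
  have hev : f =ᶠ[𝓝 x] F := by filter_upwards [ht] with y hy using hFf hy
  refine clarkeSubdifferential_congr hev.symm ?_
  have hcomp := isCompact_clarkeSubdifferential_of_lipschitzWith hF x
  by_contra hg
  obtain ⟨L, u, hL, hLg⟩ := geometric_hahn_banach_closed_point (convex_convexHull ℝ _)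
    hcomp.convexHull_of_finiteDimensional.isClosed hg
  set h := (InnerProductSpace.toDual ℝ E).symm L
  have hLh : ∀ v, L v = inner ℝ v h := fun v => by
    rw [real_inner_comm, InnerProductSpace.toDual_symm_apply]
  -- If this failed along a sequence tending to `x`, compactness would give a limiting gradient `v`
  -- with `L v ≥ u`, against the separation.
  have hgrad : ∀ᶠ y in 𝓝 x, DifferentiableAt ℝ F y → fderiv ℝ F y h ≤ u := by
    by_contra hcon
    rw [not_eventually] at hcon
    obtain ⟨y, hy, hyp⟩ := exists_seq_forall_of_frequently hcon
    simp only [Classical.not_imp, not_le] at hyp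
    have hbd : ∀ k, gradient F (y k) ∈ Metric.closedBall (0 : E) K := fun k => by
      simpa [gradient] using norm_fderiv_le_of_lipschitz ℝ hF
    obtain ⟨v, -, σ, hσ, hv⟩ := (isCompact_closedBall (0 : E) K).tendsto_subseq hbd
    have hvL : L v < u := hL v (subset_convexHull ℝ _
      ⟨y ∘ σ, hy.comp hσ.tendsto_atTop, fun k => (hyp _).1, hv⟩)
    refine hvL.not_ge (ge_of_tendsto' ((L.continuous.tendsto v).comp hv) fun k => ?_)
    simp only [Function.comp_apply, hLh, inner_gradient_left]
    exact (hyp _).2.le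
  obtain ⟨r, hr, hball⟩ := Metric.eventually_nhds_iff_ball.1 hgrad
  have hline : HasDerivAt (fun s : ℝ => φ (x + s • h)) (inner ℝ g h) 0 := by
    have h1 : HasDerivAt (fun s : ℝ => x + s • h) h 0 := by
      simpa using ((hasDerivAt_id (0 : ℝ)).smul_const h).const_add x
    have h2 : HasFDerivAt φ (InnerProductSpace.toDual ℝ E g) (x + (0 : ℝ) • h) := by
      simpa using hφ.hasFDerivAt
    simpa [Function.comp_def] using h2.comp_hasDerivAt 0 h1
  have hcont : Tendsto (fun s : ℝ => x + s • h) (𝓝[>] 0) (𝓝 x) := by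
    have : Continuous fun s : ℝ => x + s • h := by fun_prop
    simpa using (this.tendsto 0).mono_left nhdsWithin_le_nhds
  have hsmall : ∀ᶠ s : ℝ in 𝓝[>] 0, s * ‖h‖ < r := by
    have : Continuous fun s : ℝ => s * ‖h‖ := by fun_prop
    have h0 : Tendsto (fun s : ℝ => s * ‖h‖) (𝓝 0) (𝓝 0) := by simpa using this.tendsto 0
    exact (h0.mono_left nhdsWithin_le_nhds).eventually (gt_mem_nhds hr)
  have hslope : Tendsto (fun s : ℝ => s⁻¹ • (φ (x + s • h) - φ x)) (𝓝[>] 0)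
      (𝓝 (inner ℝ g h)) := by
    simpa using hline.tendsto_slope_zero_right
  have hge : inner ℝ g h ≤ u := by
    refine le_of_tendsto hslope ?_
    filter_upwards [hsmall, hcont.eventually hle, hcont.eventually hev, self_mem_nhdsWithin]
      with s hs hs1 hs2 hs0
    have h3 := hF.sub_le_of_fderiv_le hball (le_of_lt hs0) hs
    rw [smul_eq_mul, inv_mul_le_iff₀ hs0, hx, hev.self_of_nhds]
    linarith
  exact absurd hge (by rw [← hLh]; exact hLg.not_ge)

end RobustDispatch

end Clarke

/-! ### Lagrange duality and the perturbed value function -/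

namespace RobustDispatch

namespace DispatchProblem

variable {n d m p : ℕ} (P : DispatchProblem n d m)

/-- The value of the problem as a function of the perturbation `z` of its constraints. -/
noncomputable def perturbedValue (z : Fin m → ℝ) : EReal :=
  ⨅ x ∈ {x | x ∈ P.X ∧ ∀ j, P.a j x + z j ≤ P.b j}, P.f x

theorem value_eq_perturbedValue (s : Vec p → Vec d → ℝ) (θ : Vec p) (ρ : ℝ) :
    P.value s θ ρ = P.perturbedValue fun j => P.exposure s j θ ρ := rfl

/-- `μ` is a Kuhn-Tucker vector of the problem perturbed by `z`. -/
structure IsMultiplier (z μ : Fin m → ℝ) : Prop where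
  nonneg : 0 ≤ μ
  le : ∀ x ∈ P.X, (((P.perturbedValue z).toReal + ∑ j, μ j * (P.b j - P.a j x - z j) : ℝ) : EReal)
    ≤ P.f x

variable {P}

theorem coe_le_lagrangian_iff {z μ : Fin m → ℝ} {v : ℝ} {x : Vec n} :
    (v : EReal) ≤ P.f x + ((∑ j, μ j * (P.a j x + z j - P.b j) : ℝ) : EReal) ↔
      ((v + ∑ j, μ j * (P.b j - P.a j x - z j) : ℝ) : EReal) ≤ P.f x := by
  have hs : ∑ j, μ j * (P.b j - P.a j x - z j) = -∑ j, μ j * (P.a j x + z j - P.b j) := by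
    rw [← Finset.sum_neg_distrib]
    exact Finset.sum_congr rfl fun j _ => by ring
  rw [hs]
  have hbot := P.f_ne_bot x
  induction h : P.f x with
  | bot => exact absurd h hbot
  | top => simp
  | coe r =>
    norm_cast
    constructor <;> intro h <;> linarith

theorem dual_le_value {s : Vec p → Vec d → ℝ} {θ : Vec p} {ρ : ℝ} {ν : Fin m → ℝ} (hν : 0 ≤ ν) :
    P.dual s θ ρ ν ≤ P.value s θ ρ := by
  refine le_iInf₂ fun x hx => (iInf₂_le x hx.1).trans ?_
  have h0 : ∑ j, ν j * (P.a j x + P.exposure s j θ ρ - P.b j) ≤ 0 :=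
    Finset.sum_nonpos fun j _ => mul_nonpos_of_nonneg_of_nonpos (hν j) (by linarith [hx.2 j])
  calc P.f x + ((∑ j, ν j * (P.a j x + P.exposure s j θ ρ - P.b j) : ℝ) : EReal)
      ≤ P.f x + ((0 : ℝ) : EReal) := by gcongr
    _ = P.f x := by simp

theorem isMultiplier_iff_dual {s : Vec p → Vec d → ℝ} {θ : Vec p} {ρ : ℝ} {μ : Fin m → ℝ} :
    P.IsMultiplier (fun j => P.exposure s j θ ρ) μ ↔
      0 ≤ μ ∧ ((P.value s θ ρ).toReal : EReal) ≤ P.dual s θ ρ μ := by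
  rw [value_eq_perturbedValue, dual, le_iInf₂_iff]
  constructor
  · exact fun h => ⟨h.nonneg, fun x hx => coe_le_lagrangian_iff.2 (h.le x hx)⟩
  · exact fun h => ⟨h.1, fun x hx => coe_le_lagrangian_iff.1 (h.2 x hx)⟩

/-- A strictly feasible point with margin `δ`, and a lower bound of the objective. -/
structure SlaterData (P : DispatchProblem n d m) (z : Fin m → ℝ) (x : Vec n) (c F δ : ℝ) :
    Prop where
  le_objective : ∀ y ∈ P.X, (c : EReal) ≤ P.f y
  mem : x ∈ P.X
  objective_eq : P.f x = F
  pos : 0 < δ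
  margin : ∀ j, δ < P.b j - P.a j x - z j

theorem _root_.convexCombo_lt {α β x y x' y' : ℝ} (hα : 0 ≤ α) (hβ : 0 ≤ β) (hαβ : α + β = 1)
    (hx : x < x') (hy : y < y') : α * x + β * y < α * x' + β * y' := by
  rcases hα.eq_or_lt with rfl | hα
  · obtain rfl : β = 1 := by linarith
    simpa using hy
  · exact add_lt_add_of_lt_of_le (mul_lt_mul_of_pos_left hx hα)
      (mul_le_mul_of_nonneg_left hy.le hβ)

theorem convex_strictEpigraph :
    Convex ℝ {q : (Fin m → ℝ) × ℝ | ∃ y ∈ P.X, P.f y < q.2 ∧ ∀ j, P.a j y + q.1 j < P.b j} := by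
  rintro ⟨z₁, r₁⟩ ⟨y₁, hy₁, hf₁, ha₁⟩ ⟨z₂, r₂⟩ ⟨y₂, hy₂, hf₂, ha₂⟩ α β hα hβ hαβ
  -- Intermediate real heights let convexity of the non-strict epigraph preserve a strict
  -- inequality.
  obtain ⟨t₁, ht₁, htr₁⟩ := EReal.lt_iff_exists_real_btwn.1 hf₁
  obtain ⟨t₂, ht₂, htr₂⟩ := EReal.lt_iff_exists_real_btwn.1 hf₂
  simp only [EReal.coe_lt_coe_iff] at htr₁ htr₂
  refine ⟨α • y₁ + β • y₂, P.X_convex hy₁ hy₂ hα hβ hαβ, ?_, fun j => ?_⟩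
  · have hf := P.f_convex (x := (y₁, t₁)) ht₁.le (y := (y₂, t₂)) ht₂.le hα hβ hαβ
    refine lt_of_le_of_lt hf ?_
    simp only [Prod.smul_mk, Prod.mk_add_mk, smul_eq_mul, EReal.coe_lt_coe_iff]
    exact convexCombo_lt hα hβ hαβ htr₁ htr₂
  · have ha := (P.a_convex j).2 (mem_univ y₁) (mem_univ y₂) hα hβ hαβ
    have h3 := convexCombo_lt hα hβ hαβ (ha₁ j) (ha₂ j)
    simp only [smul_eq_mul, Prod.smul_mk, Prod.mk_add_mk, Pi.add_apply, Pi.smul_apply] at *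
    have : α * P.b j + β * P.b j = P.b j := by rw [← add_mul, hαβ, one_mul]
    linarith

/-- For fixed `y` the strict conditions are open in the perturbation and height, so no continuity in
`y` is needed. -/
theorem isOpen_strictEpigraph :
    IsOpen {q : (Fin m → ℝ) × ℝ | ∃ y ∈ P.X, P.f y < q.2 ∧ ∀ j, P.a j y + q.1 j < P.b j} := by
  have : {q : (Fin m → ℝ) × ℝ | ∃ y ∈ P.X, P.f y < q.2 ∧ ∀ j, P.a j y + q.1 j < P.b j} =
      ⋃ y ∈ P.X, {q | P.f y < q.2} ∩ ⋂ j, {q | P.a j y + q.1 j < P.b j} := by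
    ext q
    simp [and_left_comm]
  rw [this]
  refine isOpen_biUnion fun y _ => IsOpen.inter ?_ (isOpen_iInter_of_finite fun j => ?_)
  · exact isOpen_lt continuous_const (continuous_coe_real_ereal.comp continuous_snd)
  · exact isOpen_lt (by fun_prop) continuous_const

namespace SlaterData

variable {z z' μ : Fin m → ℝ} {x : Vec n} {c F δ : ℝ}

theorem eventually (h : P.SlaterData z x c F δ) : ∀ᶠ z' in 𝓝 z, P.SlaterData z' x c F δ := by
  have h1 : ∀ᶠ z' in 𝓝 z, ∀ j, δ < P.b j - P.a j x - z' j := by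
    rw [eventually_all]
    intro j
    have hc : Continuous fun z' : Fin m → ℝ => P.b j - P.a j x - z' j := by fun_prop
    exact hc.continuousAt.eventually (lt_mem_nhds (h.margin j))
  filter_upwards [h1] with z' hz'
  exact ⟨h.le_objective, h.mem, h.objective_eq, h.pos, hz'⟩

theorem le_perturbedValue (h : P.SlaterData z x c F δ) (z' : Fin m → ℝ) :
    (c : EReal) ≤ P.perturbedValue z' :=
  le_iInf₂ fun y hy => h.le_objective y hy.1

theorem perturbedValue_le (h : P.SlaterData z x c F δ) : P.perturbedValue z ≤ F := by
  rw [← h.objective_eq]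
  exact iInf₂_le x ⟨h.mem, fun j => by linarith [h.margin j, h.pos]⟩

theorem ne_bot (h : P.SlaterData z x c F δ) : P.perturbedValue z ≠ ⊥ :=
  fun hb => EReal.coe_ne_bot c (le_bot_iff.1 (hb ▸ h.le_perturbedValue z))

theorem ne_top (h : P.SlaterData z x c F δ) : P.perturbedValue z ≠ ⊤ :=
  fun hb => EReal.coe_ne_top F (top_le_iff.1 (hb ▸ h.perturbedValue_le))

theorem coe_toReal (h : P.SlaterData z x c F δ) :
    ((P.perturbedValue z).toReal : EReal) = P.perturbedValue z :=
  EReal.coe_toReal h.ne_top h.ne_bot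

theorem le_toReal (h : P.SlaterData z x c F δ) : c ≤ (P.perturbedValue z).toReal := by
  have := h.le_perturbedValue z
  rw [← h.coe_toReal] at this
  exact_mod_cast this

/-- Testing the Kuhn-Tucker inequality at the Slater point, where every slack exceeds `δ`, gives c +
δ ∑ μ ≤ F. -/
theorem sum_le_of_isMultiplier (h : P.SlaterData z x c F δ) (hμ : P.IsMultiplier z μ) :
    ∑ j, μ j ≤ (F - c) / δ := by
  have h1 := hμ.le x h.mem
  rw [h.objective_eq, EReal.coe_le_coe_iff] at h1
  rw [le_div_iff₀ h.pos, Finset.sum_mul]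
  have h2 : ∑ j, μ j * δ ≤ ∑ j, μ j * (P.b j - P.a j x - z j) :=
    Finset.sum_le_sum fun j _ => mul_le_mul_of_nonneg_left (h.margin j).le (hμ.nonneg j)
  linarith [h.le_toReal]

/-- A point feasible for `z'` has b - a ≥ z', so the Kuhn-Tucker inequality at `z` bounds its
objective from below. -/
theorem toReal_add_le (h : P.SlaterData z' x c F δ) (hμ : P.IsMultiplier z μ) :
    (P.perturbedValue z).toReal + ∑ j, μ j * (z' j - z j) ≤ (P.perturbedValue z').toReal := by
  rw [← EReal.coe_le_coe_iff, h.coe_toReal]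
  refine le_iInf₂ fun y hy => le_trans ?_ (hμ.le y hy.1)
  rw [EReal.coe_le_coe_iff]
  gcongr with j _
  · exact hμ.nonneg j
  · linarith [hy.2 j]

/-- Separate `(z, v)` from the open convex strict epigraph. The Slater point makes the hyperplane
non-vertical (`κ > 0`), and dividing by `κ` gives the multiplier. -/
theorem exists_isMultiplier (h : P.SlaterData z x c F δ) : ∃ μ, P.IsMultiplier z μ := by
  set v := (P.perturbedValue z).toReal
  have hv : (v : EReal) = P.perturbedValue z := h.coe_toReal
  have hvF : v ≤ F := by
    have := h.perturbedValue_le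
    rw [← hv] at this
    exact_mod_cast this
  obtain ⟨L, hL⟩ := geometric_hahn_banach_open_point (x := (z, v)) (convex_strictEpigraph (P := P))
    isOpen_strictEpigraph (by
      rintro ⟨y, hy, hfy, hay⟩
      refine hfy.not_ge ?_
      rw [hv]
      exact iInf₂_le y ⟨hy, fun j => (hay j).le⟩)
  set κ := -L (0, 1)
  have hdec : ∀ (w : Fin m → ℝ) (r : ℝ), L (w, r) = ∑ j, w j * L (Pi.single j 1, 0) - κ * r := by
    intro w r
    have : (w, r) = ∑ j, w j • ((Pi.single j 1 : Fin m → ℝ), (0 : ℝ)) + r • (0, 1) := by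
      refine Prod.ext ?_ ?_
      · ext i
        simp [Prod.fst_sum, Finset.sum_apply, Pi.single_apply]
      · simp [Prod.snd_sum]
    conv_lhs => rw [this]
    simp only [map_add, map_sum, map_smul, smul_eq_mul, κ]
    ring
  have hmem : ∀ (w : Fin m → ℝ) (r : ℝ) (y : Vec n), y ∈ P.X → P.f y < (r : EReal) →
      (∀ j, P.a j y + w j < P.b j) → ∑ j, (w j - z j) * L (Pi.single j 1, 0) < κ * (r - v) := by
    intro w r y hy hf ha
    have := hL (w, r) ⟨y, hy, hf, ha⟩
    rw [hdec, hdec] at this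
    simp only [sub_mul, Finset.sum_sub_distrib]
    linarith
  have hfx : ∀ j, P.a j x + z j < P.b j := fun j => by linarith [h.margin j, h.pos]
  have hκ : 0 < κ := by
    have := hmem z (F + 1) x h.mem (by rw [h.objective_eq]; exact_mod_cast lt_add_one F) hfx
    simp only [sub_self, zero_mul, Finset.sum_const_zero] at this
    exact pos_of_mul_pos_left this (by linarith)
  have hkey : ∀ (w : Fin m → ℝ) (r : ℝ) (y : Vec n), y ∈ P.X → P.f y < (r : EReal) →
      (∀ j, P.a j y + w j < P.b j) →
      v + ∑ j, (L (Pi.single j 1, 0) / κ) * (w j - z j) < r := by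
    intro w r y hy hf ha
    have h1 := hmem w r y hy hf ha
    have h2 : ∑ j, (L (Pi.single j 1, 0) / κ) * (w j - z j) =
        (∑ j, (w j - z j) * L (Pi.single j 1, 0)) / κ := by
      rw [Finset.sum_div]
      exact Finset.sum_congr rfl fun j _ => by ring
    rw [h2]
    have := (div_lt_iff₀' hκ).2 h1
    linarith
  refine ⟨fun j => L (Pi.single j 1, 0) / κ, fun j => ?_, fun y hy => ?_⟩
  · by_contra hneg
    simp only [Pi.zero_apply, not_le] at hneg
    set μj := L (Pi.single j 1, 0) / κ with hμj
    -- Lowering `z j` by `t` keeps `x` strictly feasible, yet raises the affine lower bound from `v`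
    -- to exactly `F + 1`, which must stay strictly below `F + 1`.
    set t := (F + 1 - v) / (-μj)
    have ht : 0 < t := div_pos (by linarith) (by linarith)
    have h1 := hkey (z - Pi.single j t) (F + 1) x h.mem
      (by rw [h.objective_eq]; exact_mod_cast lt_add_one F) (fun i => by
        have h0 : 0 ≤ (Pi.single j t : Fin m → ℝ) i := by
          by_cases hij : i = j
          · subst hij; simpa using ht.le
          · simp [hij]
        rw [Pi.sub_apply]
        linarith [hfx i])
    have h2 : ∑ i, (L (Pi.single i 1, 0) / κ) * ((z - Pi.single j t : Fin m → ℝ) i - z i) = - (μj * t) := by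
      rw [Finset.sum_eq_single j]
      · simp [hμj]
      · intro i _ hij
        simp [hij]
      · simp
    rw [h2] at h1
    have h3 : -(μj * t) = F + 1 - v := by
      rw [← neg_mul]
      exact mul_div_cancel₀ _ (by linarith)
    linarith
  · have hbot := P.f_ne_bot y
    by_cases htop : P.f y = ⊤
    · rw [htop]; exact le_top
    obtain ⟨r, hr⟩ : ∃ r : ℝ, P.f y = r := ⟨(P.f y).toReal, (EReal.coe_toReal htop hbot).symm⟩
    rw [hr, EReal.coe_le_coe_iff]
    -- The perturbation making every constraint at `y` tight is lowered by `ε`, and the height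
    -- raised by `ε`, to enter the strict epigraph; then `ε` tends to 0.
    have hlim : Tendsto (fun ε : ℝ => v + ∑ j, (L (Pi.single j 1, 0) / κ) *
        ((P.b j - P.a j y - ε) - z j)) (𝓝[>] 0)
        (𝓝 (v + ∑ j, (L (Pi.single j 1, 0) / κ) * (P.b j - P.a j y - z j))) := by
      have : Continuous (fun ε : ℝ => v + ∑ j, (L (Pi.single j 1, 0) / κ) *
        ((P.b j - P.a j y - ε) - z j)) := by fun_prop
      simpa using (this.tendsto 0).mono_left nhdsWithin_le_nhds
    have hlim2 : Tendsto (fun ε : ℝ => r + ε) (𝓝[>] 0) (𝓝 r) := by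
      have : Continuous (fun ε : ℝ => r + ε) := by fun_prop
      simpa using (this.tendsto 0).mono_left nhdsWithin_le_nhds
    refine le_of_tendsto_of_tendsto hlim hlim2 ?_
    filter_upwards [self_mem_nhdsWithin] with ε hε
    have hε0 : (0 : ℝ) < ε := hε
    exact (hkey (fun j => P.b j - P.a j y - ε) (r + ε) y hy
      (by rw [hr]; exact_mod_cast lt_add_of_pos_right r hε0) (fun j => by linarith)).le

theorem abs_sum_mul_le {ι : Type*} [Fintype ι] {μ : ι → ℝ} (hμ : 0 ≤ μ) (w : ι → ℝ) :
    |∑ j, μ j * w j| ≤ (∑ j, μ j) * ‖w‖ := by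
  rw [Finset.sum_mul]
  refine (Finset.abs_sum_le_sum_abs _ _).trans (Finset.sum_le_sum fun j _ => ?_)
  rw [abs_mul, abs_of_nonneg (hμ j)]
  exact mul_le_mul_of_nonneg_left (norm_le_pi_norm w j) (hμ j)

theorem toReal_sub_le (h : P.SlaterData z x c F δ) (h' : P.SlaterData z' x c F δ) :
    (P.perturbedValue z).toReal - (P.perturbedValue z').toReal ≤ (F - c) / δ * ‖z - z'‖ := by
  obtain ⟨μ, hμ⟩ := h.exists_isMultiplier
  have h1 := h'.toReal_add_le hμ
  have h2 := (abs_le.1 (abs_sum_mul_le hμ.nonneg (z' - z))).1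
  have h3 := mul_le_mul_of_nonneg_right (h.sum_le_of_isMultiplier hμ) (norm_nonneg (z' - z))
  rw [norm_sub_rev]
  simp only [Pi.sub_apply] at h2
  linarith

theorem exists_lipschitzOnWith (h : P.SlaterData z x c F δ) :
    ∃ K : NNReal, ∃ t ∈ 𝓝 z, LipschitzOnWith K (fun z' => (P.perturbedValue z').toReal) t := by
  refine ⟨((F - c) / δ).toNNReal, _, h.eventually, LipschitzOnWith.of_dist_le_mul ?_⟩
  intro z₁ h₁ z₂ h₂
  have hle := Real.le_coe_toNNReal ((F - c) / δ)
  have h3 := toReal_sub_le h₁ h₂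
  have h4 := toReal_sub_le h₂ h₁
  rw [norm_sub_rev] at h4
  rw [Real.dist_eq, dist_eq_norm, abs_le]
  have := mul_le_mul_of_nonneg_right hle (norm_nonneg (z₁ - z₂))
  constructor <;> linarith

theorem continuousAt_toReal (h : P.SlaterData z x c F δ) :
    ContinuousAt (fun z' => (P.perturbedValue z').toReal) z := by
  obtain ⟨K, t, ht, hK⟩ := h.exists_lipschitzOnWith
  exact hK.continuousOn.continuousAt ht

theorem isMultiplier_of_tendsto (h : P.SlaterData z x c F δ) {u ν : ℕ → Fin m → ℝ}
    (hu : Tendsto u atTop (𝓝 z)) (hν : Tendsto ν atTop (𝓝 μ))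
    (hm : ∀ k, P.IsMultiplier (u k) (ν k)) : P.IsMultiplier z μ := by
  have h0 : (0 : Fin m → ℝ) ≤ μ := ge_of_tendsto' hν fun k => (hm k).nonneg
  refine ⟨h0, fun y hy => ?_⟩
  have hlim : Tendsto (fun k => (P.perturbedValue (u k)).toReal +
      ∑ j, ν k j * (P.b j - P.a j y - u k j)) atTop
      (𝓝 ((P.perturbedValue z).toReal + ∑ j, μ j * (P.b j - P.a j y - z j))) := by
    refine (h.continuousAt_toReal.tendsto.comp hu).add (tendsto_finsetSum _ fun j _ => ?_)
    rw [tendsto_pi_nhds] at hu hν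
    exact (hν j).mul (tendsto_const_nhds.sub (hu j))
  exact le_of_tendsto' (EReal.tendsto_coe.2 hlim) fun k => (hm k).le y hy

/-- Nearby multipliers lie in a fixed compact box, and their limit points are multipliers at `z`,
hence equal `μ`. -/
theorem eventually_multiplier_near (h : P.SlaterData z x c F δ)
    (huniq : ∀ ν, P.IsMultiplier z ν → ν = μ) {ε : ℝ} (hε : 0 < ε) :
    ∀ᶠ z' in 𝓝 z, ∀ ν, P.IsMultiplier z' ν → ‖ν - μ‖ < ε := by
  by_contra hcon
  rw [not_eventually] at hcon
  obtain ⟨u, hu, hp⟩ := exists_seq_forall_of_frequently (hcon.and_eventually h.eventually)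
  have hp' : ∀ k, ∃ ν, P.IsMultiplier (u k) ν ∧ ε ≤ ‖ν - μ‖ := fun k => by
    simpa only [not_forall, not_lt, exists_prop] using (hp k).1
  choose ν hν hνε using hp'
  have hbd : ∀ k, ν k ∈ Icc (0 : Fin m → ℝ) fun _ => (F - c) / δ := fun k =>
    ⟨(hν k).nonneg, fun j => (Finset.single_le_sum (fun i _ => (hν k).nonneg i)
      (Finset.mem_univ j)).trans ((hp k).2.sum_le_of_isMultiplier (hν k))⟩
  obtain ⟨l, -, σ, hσ, hl⟩ := isCompact_Icc.tendsto_subseq hbd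
  have hlμ : l = μ := huniq l
    (h.isMultiplier_of_tendsto (hu.comp hσ.tendsto_atTop) hl fun k => hν _)
  have hge : ε ≤ ‖l - μ‖ := ge_of_tendsto' ((hl.sub_const μ).norm) fun k => hνε _
  rw [hlμ, sub_self, norm_zero] at hge
  exact hge.not_gt hε

/-- A unique Kuhn-Tucker vector is the derivative of the perturbed value. -/
theorem hasFDerivAt_toReal (h : P.SlaterData z x c F δ) (hμ : P.IsMultiplier z μ)
    (huniq : ∀ ν, P.IsMultiplier z ν → ν = μ) :
    HasFDerivAt (fun z' => (P.perturbedValue z').toReal)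
      (∑ j, μ j • ContinuousLinearMap.proj (R := ℝ) (φ := fun _ : Fin m => ℝ) j) z := by
  rw [hasFDerivAt_iff_isLittleO, Asymptotics.isLittleO_iff]
  intro ε hε
  have hm : (0 : ℝ) < m + 1 := by positivity
  filter_upwards [h.eventually, h.eventually_multiplier_near huniq (div_pos hε hm)]
    with z' h' hnear
  obtain ⟨ν, hν⟩ := h'.exists_isMultiplier
  -- The inequality at `z` bounds the increment from below by `μ`, and the one at `z'` bounds it
  -- from above by `ν`; only `ν - μ` remains to be estimated.
  have h1 := h'.toReal_add_le hμ
  have h2 := h.toReal_add_le hν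
  have hL : (∑ j, μ j • ContinuousLinearMap.proj (R := ℝ) (φ := fun _ : Fin m => ℝ) j) (z' - z) =
      ∑ j, μ j * (z' j - z j) := by
    simp
  have h3 : ∑ j, (ν j - μ j) * (z' j - z j) ≤ ε * ‖z' - z‖ := by
    have hj : ∀ j ∈ Finset.univ, (ν j - μ j) * (z' j - z j) ≤ ε / (m + 1) * ‖z' - z‖ := by
      intro j _
      refine (le_abs_self _).trans ?_
      rw [abs_mul]
      exact mul_le_mul ((norm_le_pi_norm (ν - μ) j).trans (hnear ν hν).le)
        (norm_le_pi_norm (z' - z) j) (abs_nonneg _) (by positivity)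
    refine (Finset.sum_le_sum hj).trans ?_
    rw [Finset.sum_const, Finset.card_univ, Fintype.card_fin, nsmul_eq_mul, ← mul_assoc]
    refine mul_le_mul_of_nonneg_right ?_ (norm_nonneg _)
    rw [mul_div_assoc', div_le_iff₀ hm]
    nlinarith
  have h4 : ∑ j, ν j * (z j - z' j) = -∑ j, ν j * (z' j - z j) := by
    rw [← Finset.sum_neg_distrib]
    exact Finset.sum_congr rfl fun j _ => by ring
  simp only [sub_mul, Finset.sum_sub_distrib] at h3
  rw [hL, Real.norm_eq_abs, abs_le]
  constructor <;> nlinarith [norm_nonneg (z' - z)]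

end SlaterData

end DispatchProblem

end RobustDispatch

/-! ### Chain rule through the exposures and the main theorem -/

namespace RobustDispatch

namespace DispatchProblem

variable {n d m p : ℕ} {P : DispatchProblem n d m}

theorem hasGradientAt_sum_smul {E : Type*} [NormedAddCommGroup E] [InnerProductSpace ℝ E]
    [CompleteSpace E] {ι : Type*} [Fintype ι] {e : ι → E → ℝ} {θ : E} (μ : ι → ℝ)
    (he : ∀ j, DifferentiableAt ℝ (e j) θ) :
    HasGradientAt (fun y => ∑ j, μ j * e j y) (∑ j, μ j • gradient (e j) θ) θ := by
  rw [hasGradientAt_iff_hasFDerivAt, map_sum]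
  simp only [map_smul]
  exact HasFDerivAt.fun_sum fun j _ => (he j).hasGradientAt.hasFDerivAt.const_mul (μ j)

namespace SlaterData

variable {E : Type*} [NormedAddCommGroup E] [InnerProductSpace ℝ E] [FiniteDimensional ℝ E]
  {e : Fin m → E → ℝ} {θ : E} {μ : Fin m → ℝ} {x : Vec n} {c F δ : ℝ}

theorem isClarkeSubgradientAt (h : P.SlaterData (fun j => e j θ) x c F δ)
    (hμ : P.IsMultiplier (fun j => e j θ) μ) (he : ∀ j, ContDiffAt ℝ 1 (e j) θ) :
    IsClarkeSubgradientAt (fun y => P.perturbedValue fun j => e j y)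
      (∑ j, μ j • gradient (e j) θ) θ := by
  have hpi : ContDiffAt ℝ 1 (fun y j => e j y) θ := contDiffAt_pi.2 he
  have hev : ∀ᶠ y in 𝓝 θ, P.SlaterData (fun j => e j y) x c F δ :=
    hpi.continuousAt.eventually h.eventually
  obtain ⟨K₁, t₁, ht₁, hK₁⟩ := hpi.exists_lipschitzOnWith
  obtain ⟨K₂, t₂, ht₂, hK₂⟩ := h.exists_lipschitzOnWith
  have ht : t₁ ∩ (fun y j => e j y) ⁻¹' t₂ ∈ 𝓝 θ :=
    inter_mem ht₁ (hpi.continuousAt.preimage_mem_nhds ht₂)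
  have hlip : LipschitzOnWith (K₂ * K₁)
      (fun y => (P.perturbedValue fun j => e j y).toReal) (t₁ ∩ (fun y j => e j y) ⁻¹' t₂) :=
    hK₂.comp (hK₁.mono inter_subset_left) fun y hy => hy.2
  refine ⟨hev.mono fun y hy => ⟨hy.ne_bot, hy.ne_top⟩, ⟨_, _, ht, hlip⟩, ?_⟩
  -- The minorant linearizes only the value in the exposures, not the exposures themselves; the
  -- constant makes it touch at `θ`.
  have hφ : HasGradientAt (fun y => ∑ j, μ j * e j y +
      ((P.perturbedValue fun j => e j θ).toReal - ∑ j, μ j * e j θ))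
      (∑ j, μ j • gradient (e j) θ) θ :=
    (hasGradientAt_sum_smul μ fun j => (he j).differentiableAt one_ne_zero).hasFDerivAt.add_const _
  refine mem_clarkeSubdifferential_of_minorant ht hlip hφ ?_ (by ring)
  filter_upwards [hev] with y hy
  have := hy.toReal_add_le hμ
  simp only [mul_sub, Finset.sum_sub_distrib] at this
  linarith

theorem hasGradientAt (h : P.SlaterData (fun j => e j θ) x c F δ)
    (hμ : P.IsMultiplier (fun j => e j θ) μ)
    (huniq : ∀ ν, P.IsMultiplier (fun j => e j θ) ν → ν = μ)
    (he : ∀ j, DifferentiableAt ℝ (e j) θ) :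
    HasGradientAt (fun y => (P.perturbedValue fun j => e j y).toReal)
      (∑ j, μ j • gradient (e j) θ) θ := by
  have hpi : HasFDerivAt (fun y j => e j y) (ContinuousLinearMap.pi fun j => fderiv ℝ (e j) θ) θ :=
    hasFDerivAt_pi.2 fun j => (he j).hasFDerivAt
  have hcomp := (h.hasFDerivAt_toReal hμ huniq).comp θ hpi
  rw [hasGradientAt_iff_hasFDerivAt]
  refine hcomp.congr_fderiv ?_
  ext v
  simp

end SlaterData

theorem LocalSlater.exists_slaterData {s : Vec p → Vec d → ℝ} {θ : Vec p} {ρ : ℝ}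
    (h : P.LocalSlater s θ ρ) :
    ∃ x c F δ, P.SlaterData (fun j => P.exposure s j θ ρ) x c F δ := by
  obtain ⟨c, hc⟩ := h.bddBelow
  obtain ⟨x, hx, hfx, hax⟩ := h.strictlyFeasible
  have hδ : ∀ᶠ δ in 𝓝[>] (0 : ℝ), ∀ j, δ < P.b j - P.a j x - P.exposure s j θ ρ := by
    rw [eventually_all]
    exact fun j => nhdsWithin_le_nhds (gt_mem_nhds (by linarith [hax j]))
  obtain ⟨δ, hδ, hδ0⟩ := (hδ.and self_mem_nhdsWithin).exists
  exact ⟨x, c, (P.f x).toReal, δ, hc, intrinsicInterior_subset hx,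
    (EReal.coe_toReal hfx.ne (P.f_ne_bot x)).symm, hδ0, hδ⟩

/-- A Kuhn-Tucker vector exists and attains the weak duality bound, so every dual maximizer attains
it too. -/
theorem SlaterData.mem_optimalDuals_iff {s : Vec p → Vec d → ℝ} {θ : Vec p} {ρ : ℝ}
    {μ : Fin m → ℝ} {x : Vec n} {c F δ : ℝ}
    (h : P.SlaterData (fun j => P.exposure s j θ ρ) x c F δ) :
    μ ∈ P.optimalDuals s θ ρ ↔ P.IsMultiplier (fun j => P.exposure s j θ ρ) μ := by
  have hv : ((P.value s θ ρ).toReal : EReal) = P.value s θ ρ := h.coe_toReal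
  rw [isMultiplier_iff_dual, hv]
  constructor
  · rintro ⟨h0, hmax⟩
    obtain ⟨ν, hν⟩ := h.exists_isMultiplier
    rw [isMultiplier_iff_dual, hv] at hν
    exact ⟨h0, hν.2.trans (hmax ν hν.1)⟩
  · exact fun hμ => ⟨hμ.1, fun ν hν => (dual_le_value hν).trans hμ.2⟩

/-- Positive homogeneity of the gauge turns the radius into a dilation factor, which identifies the
derivative in the radius. -/
theorem exposure_eq_mul {Θ : Set (Vec p)} {s : Vec p → Vec d → ℝ} (hs : GaugeRegular Θ s)
    {θ : Vec p} (hθ : θ ∈ Θ) {ρ : ℝ} (hρ : 0 < ρ) (j : Fin m) :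
    P.exposure s j θ ρ = ρ * P.exposure s j θ 1 := by
  have hset : uncertaintySet s θ ρ = ρ • uncertaintySet s θ 1 := by
    ext u
    rw [mem_smul_set_iff_inv_smul_mem₀ hρ.ne']
    simp only [uncertaintySet, mem_ofPred_eq]
    rw [hs.eq_gauge θ hθ, gauge_smul_of_nonneg (inv_nonneg.2 hρ.le), smul_eq_mul,
      inv_mul_le_iff₀ hρ, mul_one]
  have himg : (fun u => inner ℝ (P.w j) u) '' (ρ • uncertaintySet s θ 1) =
      ρ • ((fun u => inner ℝ (P.w j) u) '' uncertaintySet s θ 1) := by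
    rw [← image_smul, ← image_smul, image_image, image_image]
    simp only [inner_smul_right, smul_eq_mul]
  rw [exposure, exposure, hset, supportFunction, himg, Real.sSup_smul_of_nonneg hρ.le, smul_eq_mul]
  rfl

end DispatchProblem

end RobustDispatch

theorem mainTheorem2 {n d m p : ℕ} (hd : 1 ≤ d)
    (P : RobustDispatch.DispatchProblem n d m)
    (Θ : Set (RobustDispatch.Vec p))
    (s : RobustDispatch.Vec p → RobustDispatch.Vec d → ℝ)
    (hgauge : RobustDispatch.GaugeRegular Θ s)
    (hsmooth : P.SupportSmooth Θ s)
    (θ : RobustDispatch.Vec p) (hθ : θ ∈ interior Θ)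
    (ρ : ℝ) (hρ : 0 < ρ)
    (hV : P.value s θ ρ < ⊤)
    (hslater : P.LocalSlater s θ ρ)
    (μ : Fin m → ℝ) (hμ : μ ∈ P.optimalDuals s θ ρ) :
    RobustDispatch.IsClarkeSubgradientAt (fun θ' => P.value s θ' ρ)
        (∑ j, μ j • gradient (fun θ' => P.exposure s j θ' ρ) θ) θ ∧
      (P.optimalDuals s θ ρ = {μ} →
        HasGradientAt (fun θ' => (P.value s θ' ρ).toReal)
          (∑ j, μ j • gradient (fun θ' => P.exposure s j θ' ρ) θ) θ) ∧
      RobustDispatch.IsClarkeSubgradientAt (fun ρ' => P.value s θ ρ')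
        (∑ j, μ j * P.exposure s j θ 1) ρ := by
  obtain ⟨x, c, F, δ, h⟩ := hslater.exists_slaterData
  have hm := h.mem_optimalDuals_iff.1 hμ
  have he : ∀ j, ContDiffAt ℝ 1 (fun θ' => P.exposure s j θ' ρ) θ := fun j =>
    (hsmooth.contDiffOn j ρ hρ).contDiffAt (isOpen_interior.mem_nhds hθ)
  have hev : ∀ j, (fun ρ' => P.exposure s j θ ρ') =ᶠ[𝓝 ρ] fun ρ' => ρ' * P.exposure s j θ 1 :=
    fun j => (lt_mem_nhds hρ).mono fun ρ' hρ' =>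
      RobustDispatch.DispatchProblem.exposure_eq_mul hgauge (interior_subset hθ) hρ' j
  have he' : ∀ j, ContDiffAt ℝ 1 (fun ρ' => P.exposure s j θ ρ') ρ := fun j =>
    ContDiffAt.congr_of_eventuallyEq (by fun_prop) (hev j)
  have hgrad : ∀ j, gradient (fun ρ' => P.exposure s j θ ρ') ρ = P.exposure s j θ 1 := fun j => by
    rw [(hev j).gradient_eq, gradient_eq_deriv']
    simp
  refine ⟨h.isClarkeSubgradientAt (e := fun j θ' => P.exposure s j θ' ρ) hm he,
    fun huniq => h.hasGradientAt (e := fun j θ' => P.exposure s j θ' ρ) hm (fun ν hν => ?_)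
      fun j => (he j).differentiableAt one_ne_zero, ?_⟩
  · have := h.mem_optimalDuals_iff.2 hν
    rwa [huniq] at this
  · have := h.isClarkeSubgradientAt (e := fun j ρ' => P.exposure s j θ ρ') hm he'
    simp only [hgrad, smul_eq_mul] at this
    exact this
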